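/- **Setting.** Fix $d,m\ge 0$. *Input codes.* For $x\in[0,1]^d$ let $Q_n(x)\in\{0,1\}^{dn}$ encode each coordinate $x_j$ by the $n$ binary digits of $\min(\lfloor 2^n x_j\rfloor,\,2^n-1)$. *Output decoder.* Fix reals $\mathrm{lo}_j,\mathrm{hi}_j$ ($1\le j\le m$). A code $y\in\{0,1\}^{m\,m_{\rm out}}$, i.e. $m$ blocks of $m_{\rm out}$ bits, is decoded by $\mathsf{Dec}_{m_{\rm out}}(y)_j=\mathrm{lo}_j+(\mathrm{hi}_j-\mathrm{lo}_j)\sum_{i=1}^{m_{\rm out}}y_{j,i}2^{-i}$. *Inputs considered.* For each pair of precisions $(n,m_{\rm out})\in\mathbb N^2$ let $X_{n,m_{\rm out}}\subseteq[0,1]^d$ be an arbitrary set, the set of inputs on which accuracy $2^{-m_{\rm out}}$ is demanded from $n$ input bits. (For instance $X_{n,m_{\rm out}}=[0,1]^d$ for all pairs; or the $n$-bit grid; or $[0,1]^d$ when $n\ge m_{\rm out}+c$ and $\emptyset$ otherwise.) *Efficient computability.* $f:[0,1]^d\to\mathbb R^m$ is *efficiently Turing computable* (on the sets $X_{n,m_{\rm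 out}}$) if there are a deterministic Turing machine $M$ and a polynomial $p$ such that for all $(n,m_{\rm out})$ and all $x\in X_{n,m_{\rm out}}$, given $Q_n(x)$ and $m_{\rm out}$ (in unary), $M$ halts within $p(n+m_{\rm out})$ steps and outputs some $y\in\{0,1\}^{m\,m_{\rm out}}$ with $\|\mathsf{Dec}_{m_{\rm out}}(y)-f(x)\|_\infty\le 2^{-m_{\rm out}}$. *Discretized maps.* A *discretization* of $f$ is a family of maps $F_{n,m_{\rm out}}:\{0,1\}^{dn}\to\{0,1\}^{m\,m_{\rm out}}$ with $\|\mathsf{Dec}_{m_{\rm out}}(F_{n,m_{\rm out}}(Q_n(x)))-f(x)\|_\infty\le 2^{-m_{\rm out}}$ for all $(n,m_{\rm out})$ and $x\in X_{n,m_{\rm out}}$. It is *polynomial-time computable* if one deterministic Turing machine outputs $F_{n,m_{\rm out}}(Q_n(x))$ from $(Q_n(x),m_{\rm out})$ within $\mathrm{poly}(n+m_{\rm out})$ steps, for all $(n,m_{\rm out})$ and $x\in X_{n,m_{\rm out}}$. **Theorem.** Let $f$ be efficiently Turing computable on the sets $X_{n,m_{\rm out}}$. Then $f$ has a polynomial-time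 computable discretization. Moreover, for every polynomial-time computable discretization $(F_{n,m_{\rm out}})$ of $f$ there is a polynomial $p$ such that for every pair $(n,m_{\rm out})$: 1. there is a finite directed acyclic graph whose internal nodes carry Boolean functions of at most $3$ arguments (fan-in $\le 3$), with at most $p(n+m_{\rm out})$ internal nodes and depth at most $p(n+m_{\rm out})$, that computes $F_{n,m_{\rm out}}$ on all codes $Q_n(x)$, $x\in X_{n,m_{\rm out}}$; 2. there is a feedforward ReLU network $\Phi_{n,m_{\rm out}}:\mathbb R^{dn}\to\mathbb R^m$ with at most $p(n+m_{\rm out})$ parameters (weights and biases) and at most $p(n+m_{\rm out})$ layers such that $$\big\|\Phi_{n,m_{\rm out}}(Q_n(x))-f(x)\big\|_\infty\le 2^{-m_{\rm out}}\qquad\text{for all }x\in X_{n,m_{\rm out}}.$$ In particular, with $X_{n,m_{\rm out}}=[0,1]^d$ for all pairs, the bound in 2 holds for all $x\in[0,1]^d$. -/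

import Mathlib

/-! ### Finite-precision encodings -/

/-- The unit cube `[0,1]^d`. -/
abbrev UnitCube (d : ℕ) : Type := Fin d → unitInterval

/-- `n` bits for each of `d` coordinates. -/
abbrev BitCode (d n : ℕ) : Type := Fin d → Fin n → Bool

/-- The quantizer `Q_n`: coordinate `x j` is encoded by the `n` binary digits (most significant
first) of the integer `min ⌊2^n x_j⌋ (2^n - 1)`. -/
noncomputable def quantize {d : ℕ} (n : ℕ) (x : UnitCube d) : BitCode d n := fun j i =>
  (min ⌊(2 : ℝ) ^ n * (x j : ℝ)⌋₊ (2 ^ n - 1)).testBit (n - 1 - (i : ℕ))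

/-- The number `0` or `1` denoted by a bit. -/
def bitVal (b : Bool) : ℝ := if b then 1 else 0

/-- The fixed-point output decoder `Dec`: the `j`-th block of bits `y_{j,0}, y_{j,1}, …` denotes the
number `lo_j + (hi_j - lo_j) * ∑_i y_{j,i} 2^{-(i+1)}`. -/
noncomputable def decode {m b : ℕ} (lo hi : Fin m → ℝ) (y : BitCode m b) : Fin m → ℝ := fun j =>
  lo j + (hi j - lo j) * ∑ i : Fin b, bitVal (y j i) * (2 : ℝ)⁻¹ ^ ((i : ℕ) + 1)

/-! ### Turing machines with a clock -/

/-- The symbols used to write inputs and outputs on the tape. -/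
inductive IOSymbol : Type
  | bit (b : Bool)
  | sep

/-- A deterministic one-tape Turing machine: finite tape alphabet `Γ` (with blank `default`)
containing distinct nonblank input/output symbols, finite state set `Λ` (with initial state
`default`), and a transition table. -/
structure TuringMachine where
  Γ : Type
  Λ : Type
  [finΓ : Finite Γ]
  [finΛ : Finite Λ]
  [inhΓ : Inhabited Γ]
  [inhΛ : Inhabited Λ]
  sym : IOSymbol → Γ
  sym_injective : Function.Injective sym
  sym_ne_blank : ∀ s, sym s ≠ default
  table : Turing.TM0.Machine Γ Λ

attribute [instance] TuringMachine.finΓ TuringMachine.finΛ TuringMachine.inhΓ TuringMachine.inhΛ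

/-- Started on the first symbol of `input` (the rest of the tape being blank), the machine halts
after at most `T` steps, and then the tape, read from the head to the right, consists of `output`
followed by blanks only. -/
def TuringMachine.OutputsWithin (M : TuringMachine) (input output : List IOSymbol) (T : ℕ) : Prop :=
  ∃ k ≤ T, ∃ c : Turing.TM0.Cfg M.Γ M.Λ,
    (fun o => o.bind (Turing.TM0.step M.table))^[k]
        (some (Turing.TM0.init (input.map M.sym))) = some c ∧
      Turing.TM0.step M.table c = none ∧
      c.Tape.right₀ = Turing.ListBlank.mk (output.map M.sym)

/-- The tape input for a code `q` and an output precision `b`: the bits of each coordinate of `q`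
followed by a separator, and then `b` in unary. -/
def inputWord {d n : ℕ} (q : BitCode d n) (b : ℕ) : List IOSymbol :=
  (List.ofFn fun j => (List.ofFn fun i => IOSymbol.bit (q j i)) ++ [IOSymbol.sep]).flatten ++
    List.replicate b (IOSymbol.bit true)

/-- The tape output for a code `y`: the blocks of bits one after the other. -/
def outputWord {m b : ℕ} (y : BitCode m b) : List IOSymbol :=
  (List.ofFn fun j => List.ofFn fun i => IOSymbol.bit (y j i)).flatten

/-- A finite-precision family: for every pair `(n, b)` of input and output precisions a map
`F_{n,b} : {0,1}^{dn} → {0,1}^{mb}`. -/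
abbrev PrecisionFamily (d m : ℕ) : Type := (n b : ℕ) → BitCode d n → BitCode m b

/-- The machine `M`, within `p (n + b)` steps on `(Q_n(x), b)`, outputs some `y` with
`‖Dec_b(y) - f(x)‖_∞ ≤ 2^{-b}`; this is required for all `n`, `b` and all `x ∈ X n b`. -/
def EfficientlyTuringComputable {d m : ℕ} (lo hi : Fin m → ℝ) (X : ℕ → ℕ → Set (UnitCube d))
    (f : UnitCube d → Fin m → ℝ) : Prop :=
  ∃ (M : TuringMachine) (p : Polynomial ℕ), ∀ n b : ℕ, ∀ x ∈ X n b, ∃ y : BitCode m b,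
    M.OutputsWithin (inputWord (quantize n x) b) (outputWord y) (p.eval (n + b)) ∧
      ‖decode lo hi y - f x‖ ≤ (2 : ℝ)⁻¹ ^ b

/-- `F` is a discretization of `f` on the sets `X n b`: on the code of any `x ∈ X n b`, the value of
`F n b` is a `b`-bit representation of `f x` to within `2^{-b}`. -/
def IsDiscretization {d m : ℕ} (lo hi : Fin m → ℝ) (X : ℕ → ℕ → Set (UnitCube d))
    (f : UnitCube d → Fin m → ℝ) (F : PrecisionFamily d m) : Prop :=
  ∀ n b : ℕ, ∀ x ∈ X n b, ‖decode lo hi (F n b (quantize n x)) - f x‖ ≤ (2 : ℝ)⁻¹ ^ b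

/-- The family `F` is computed, on the codes of the points of the sets `X n b`, by one Turing
machine in time polynomial in `n + b`. -/
def PolyTimeComputable {d m : ℕ} (X : ℕ → ℕ → Set (UnitCube d)) (F : PrecisionFamily d m) : Prop :=
  ∃ (M : TuringMachine) (p : Polynomial ℕ), ∀ n b : ℕ, ∀ x ∈ X n b,
    M.OutputsWithin (inputWord (quantize n x) b) (outputWord (F n b (quantize n x)))
      (p.eval (n + b))

/-! ### Compositional DAGs of Boolean functions -/

/-- A finite DAG of local Boolean functions, with inputs indexed by `I` and outputs by `O`.
`V` is the set of internal nodes; node `v` applies `gate v` to the values of its `arity v` parents,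
each of which is an input or an internal node. -/
structure BooleanDAG (I O : Type) where
  V : Type
  [finV : Fintype V]
  arity : V → ℕ
  parent : (v : V) → Fin (arity v) → I ⊕ V
  gate : (v : V) → (Fin (arity v) → Bool) → Bool
  out : O → I ⊕ V
  acyclic : WellFounded fun w v : V => ∃ i, parent v i = Sum.inr w

attribute [instance] BooleanDAG.finV

namespace BooleanDAG

variable {I O : Type} (C : BooleanDAG I O)

/-- The value at an internal node, for the input `x`. -/
noncomputable def val (x : I → Bool) : C.V → Bool :=
  C.acyclic.fix fun v ih => C.gate v fun i =>
    match h : C.parent v i with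
    | Sum.inl a => x a
    | Sum.inr w => ih w ⟨i, h⟩

/-- The level of an internal node: the number of internal nodes on a longest path ending in it. -/
noncomputable def level : C.V → ℕ :=
  C.acyclic.fix fun v ih => 1 + Finset.univ.sup fun i =>
    match h : C.parent v i with
    | Sum.inl _ => 0
    | Sum.inr w => ih w ⟨i, h⟩

/-- The function computed by the DAG. -/
noncomputable def eval (x : I → Bool) : O → Bool := fun o => Sum.elim x (C.val x) (C.out o)

/-- The number of internal nodes. -/
def size : ℕ := Fintype.card C.V

/-- The number of internal nodes on a longest path. -/
noncomputable def depth : ℕ := Finset.univ.sup C.level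

/-- Every local function has at most `k` arguments. -/
def FanInLE (k : ℕ) : Prop := ∀ v, C.arity v ≤ k

theorem val_eq (x : I → Bool) (v : C.V) :
    C.val x v = C.gate v fun i => Sum.elim x (C.val x) (C.parent v i) := by
  unfold val
  rw [WellFounded.fix_eq]
  congr 1
  funext i
  split <;> rename_i h <;> simp [h]

theorem level_eq (v : C.V) :
    C.level v = 1 + Finset.univ.sup fun i => Sum.elim (fun _ => 0) C.level (C.parent v i) := by
  unfold level
  rw [WellFounded.fix_eq]
  congr 2
  funext i
  split <;> rename_i h <;> simp [h]

end BooleanDAG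

/-! ### Feedforward ReLU networks -/

/-- A fully connected feedforward ReLU network with input units indexed by `ι` and output units
indexed by `O`: finitely many hidden layers `z ↦ max (W z + c) 0`, then an affine output layer. -/
inductive ReLUNet (O : Type) : Type → Type 1
  | output {ι : Type} (W : Matrix O ι ℝ) (c : O → ℝ) : ReLUNet O ι
  | hidden {ι : Type} {h : ℕ} (W : Matrix (Fin h) ι ℝ) (c : Fin h → ℝ)
      (rest : ReLUNet O (Fin h)) : ReLUNet O ι

namespace ReLUNet

variable {O : Type}

/-- The function computed by the network. -/
noncomputable def eval : {ι : Type} → [Fintype ι] → ReLUNet O ι → (ι → ℝ) → O → ℝ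
  | _, _, output W c, z => fun o => (W.mulVec z) o + c o
  | _, _, hidden W c rest, z => rest.eval fun k => max ((W.mulVec z) k + c k) 0

/-- The number of layers (hidden layers and output layer). -/
def depth : {ι : Type} → ReLUNet O ι → ℕ
  | _, output _ _ => 1
  | _, hidden _ _ rest => 1 + rest.depth

/-- The number of parameters, i.e. of all entries of all weight matrices and bias vectors. -/
noncomputable def size : {ι : Type} → ReLUNet O ι → ℕ
  | ι, output _ _ => Nat.card O * Nat.card ι + Nat.card O
  | ι, hidden (h := h) _ _ rest => h * Nat.card ι + h + rest.size

end ReLUNet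

/-! ### The two forms of efficient computability agree -/

theorem outputWord_injective {m b : ℕ} : Function.Injective (outputWord (m := m) (b := b)) := by
  intro y z h
  unfold outputWord at h
  have hl : ∀ w : BitCode m b, (List.ofFn fun j => List.ofFn fun i => IOSymbol.bit (w j i)).map
      List.length = List.replicate m b := by
    intro w
    rw [List.map_ofFn]
    simp [Function.comp_def, List.ofFn_const]
  have h2 := List.eq_iff_flatten_eq.2 ⟨h, (hl y).trans (hl z).symm⟩
  have h3 := List.ofFn_injective h2
  funext j i
  have h4 := List.ofFn_injective (congrFun h3 j)
  have h5 := congrFun h4 i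
  injection h5

theorem TuringMachine.OutputsWithin.unique {M : TuringMachine} {w u v : List IOSymbol} {S T : ℕ}
    (hu : M.OutputsWithin w u S) (hv : M.OutputsWithin w v T) (hlen : u.length = v.length) :
    u = v := by
  obtain ⟨k, -, c, hk, hc, hcu⟩ := hu
  obtain ⟨l, -, e, hl, he, hev⟩ := hv
  set g : Option (Turing.TM0.Cfg M.Γ M.Λ) → Option (Turing.TM0.Cfg M.Γ M.Λ) :=
    fun o => o.bind (Turing.TM0.step M.table) with hg
  have hnone : ∀ j, g^[j] none = none := fun j => Function.iterate_fixed (by simp [hg]) j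
  have key : ∀ (a a' : Turing.TM0.Cfg M.Γ M.Λ) (s t : ℕ), s ≤ t →
      g^[s] (some (Turing.TM0.init (w.map M.sym))) = some a →
      g^[t] (some (Turing.TM0.init (w.map M.sym))) = some a' →
      Turing.TM0.step M.table a = none → a = a' := by
    intro a a' s t hst ha ha' hh
    obtain ⟨r, rfl⟩ := Nat.exists_eq_add_of_le hst
    rw [Nat.add_comm, Function.iterate_add_apply, ha] at ha'
    cases r with
    | zero => simpa using ha'
    | succ r =>
      rw [Function.iterate_succ_apply] at ha'
      simp [hg, hh] at ha'
      rw [← hg, hnone] at ha'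
      cases ha'
  have hce : c = e := by
    rcases le_total k l with h | h
    · exact key c e k l h hk hl hc
    · exact (key e c l k h hl hk he).symm
  subst hce
  rw [hcu] at hev
  apply List.map_injective_iff.2 M.sym_injective
  refine List.ext_getElem (by simpa using hlen) fun i h1 h2 => ?_
  have := congrArg (fun L => Turing.ListBlank.nth L i) hev
  simpa [Turing.ListBlank.nth_mk, List.getI_eq_getElem _ h1, List.getI_eq_getElem _ h2] using this

theorem outputWord_length {m b : ℕ} (y : BitCode m b) : (outputWord y).length = m * b := by
  simp [outputWord, List.length_flatten, List.map_ofFn, Function.comp_def, List.ofFn_const]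

/-- A function is efficiently Turing computable if and only if it has a discretization that is
computed in polynomial time. -/
theorem efficientlyTuringComputable_iff {d m : ℕ} (lo hi : Fin m → ℝ)
    (X : ℕ → ℕ → Set (UnitCube d)) (f : UnitCube d → Fin m → ℝ) :
    EfficientlyTuringComputable lo hi X f ↔
      ∃ F : PrecisionFamily d m, IsDiscretization lo hi X f F ∧ PolyTimeComputable X F := by
  classical
  constructor
  · rintro ⟨M, p, h⟩
    choose! Y hY hYf using h
    have hdet : ∀ n b, ∀ x ∈ X n b, ∀ x' ∈ X n b, quantize n x = quantize n x' →
        Y n b x = Y n b x' := by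
      intro n b x hx x' hx' hq
      have h1 := hY n b x hx
      rw [hq] at h1
      exact outputWord_injective (h1.unique (hY n b x' hx') (by simp [outputWord_length]))
    let F : PrecisionFamily d m := fun n b q =>
      if hq : ∃ x, x ∈ X n b ∧ quantize n x = q then Y n b hq.choose else fun _ _ => false
    have hF : ∀ n b, ∀ x ∈ X n b, F n b (quantize n x) = Y n b x := by
      intro n b x hx
      have hq : ∃ x', x' ∈ X n b ∧ quantize n x' = quantize n x := ⟨x, hx, rfl⟩
      simp only [F, dif_pos hq]
      exact hdet n b _ hq.choose_spec.1 x hx hq.choose_spec.2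
    refine ⟨F, fun n b x hx => ?_, M, p, fun n b x hx => ?_⟩
    · rw [hF n b x hx]; exact hYf n b x hx
    · rw [hF n b x hx]; exact hY n b x hx
  · rintro ⟨F, hF, M, p, h⟩
    exact ⟨M, p, fun n b x hx => ⟨_, h n b x hx, hF n b x hx⟩⟩

/-!
The classical simulation of a polynomial-time Turing machine by polynomial-size circuits, followed
by the translation of circuits into ReLU networks.

Both kinds of networks are obtained from straight-line programs (`IsStraightLine`): lists of Boolean
functions of the input bits, each obtained from at most three input bits or earlier entries by a
Boolean function. Costs are counted by the relation `Derives A c B`: from the functions in `A`, the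
functions in `B` are obtained by at most `c` further instructions. A function with values in a finite type
is represented by the indicators of its values, and applying a map to such a function costs a
constant (`Derives.map`).

Tape cells are indexed relative to the head of the machine. With this indexing the new content of a
cell depends only on the state, the scanned symbol, and the old contents of the cell and its two
neighbours, whatever the position of the head. So one step costs a constant number of instructions
for each cell (`TuringMachine.exists_derives_next`), and knowing the cells within distance `r` of
the head after `t` steps costs `O((t + 1) (r + t + 1))` instructions
(`TuringMachine.exists_derives_run`). A halted machine keeps its configuration, so that after the
full time bound the output can be read off the cells to the right of the head, for all inputs at
the same time (`PolyTimeComputable.exists_isStraightLine`).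

A straight-line program is a DAG of fan-in at most three whose depth is at most its length
(`IsStraightLine.exists_booleanDAG`). It is also a ReLU network with one hidden layer for each
instruction: on `{0,1}^k`, the indicator of a point is a single ReLU unit, every Boolean function is
a linear combination of these indicators, and nonnegative values pass through a ReLU layer unchanged
(`IsStraightLine.exists_reLUNet`). The decoder is affine and becomes the output layer; hence the
network computes exactly the decoded value of the discretization.
-/

/-! ### Straight-line programs of Boolean functions -/

/-- `IsStraightLine L`: the list `L` of Boolean functions of the input bits, read from its end to
its beginning, is a straight-line program, i.e. each entry is obtained by applying a Boolean
function of at most three arguments to input bits and earlier entries. -/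
inductive IsStraightLine {I : Type} : List ((I → Bool) → Bool) → Prop
  | nil : IsStraightLine []
  | cons {L : List ((I → Bool) → Bool)} (k : ℕ) (hk : k ≤ 3) (g : (Fin k → Bool) → Bool)
      (par : Fin k → (I → Bool) → Bool)
      (hpar : ∀ i, (∃ a, par i = fun x => x a) ∨ par i ∈ L) (hL : IsStraightLine L) :
      IsStraightLine ((fun x => g fun i => par i x) :: L)

/-- `Derives A c B`: every straight-line program containing the functions in `A` can be extended by
at most `c` instructions to one which also contains the functions in `B`. -/
def Derives {I : Type} (A : Set ((I → Bool) → Bool)) (c : ℕ) (B : Set ((I → Bool) → Bool)) : Prop :=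
  ∀ L, IsStraightLine L → (∀ f ∈ A, f ∈ L) →
    ∃ L', IsStraightLine L' ∧ (∀ f ∈ L, f ∈ L') ∧ (∀ f ∈ B, f ∈ L') ∧ L'.length ≤ L.length + c

namespace Derives

variable {I : Type} {A A' B B' C : Set ((I → Bool) → Bool)} {c c' d : ℕ}

theorem mono (h : Derives A c B) (hA : A ⊆ A') (hB : B' ⊆ B) (hc : c ≤ c') : Derives A' c' B' := by
  intro L hL hAL
  obtain ⟨L', h1, h2, h3, h4⟩ := h L hL fun f hf => hAL f (hA hf)
  exact ⟨L', h1, h2, fun f hf => h3 f (hB hf), by omega⟩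

theorem of_subset (h : B ⊆ A) : Derives A 0 B := fun L hL hA =>
  ⟨L, hL, fun _ hf => hf, fun f hf => hA f (h hf), le_rfl⟩

/-- Functions that have been derived remain available. -/
theorem trans (h : Derives A c B) (h' : Derives (A ∪ B) d C) : Derives A (c + d) C := by
  intro L hL hA
  obtain ⟨L', h1, h2, h3, h4⟩ := h L hL hA
  obtain ⟨L'', k1, k2, k3, k4⟩ := h' L' h1 fun f hf => hf.elim (fun hf => h2 f (hA f hf)) (h3 f)
  exact ⟨L'', k1, fun f hf => k2 f (h2 f hf), k3, by omega⟩

theorem union (h : Derives A c B) (h' : Derives A d C) : Derives A (c + d) (B ∪ C) := by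
  intro L hL hA
  obtain ⟨L', h1, h2, h3, h4⟩ := h L hL hA
  obtain ⟨L'', k1, k2, k3, k4⟩ := h' L' h1 fun f hf => h2 f (hA f hf)
  exact ⟨L'', k1, fun f hf => k2 f (h2 f hf), fun f hf => hf.elim (fun hf => k2 f (h3 f hf)) (k3 f),
    by omega⟩

theorem biUnion {ι : Type*} (s : Finset ι) {B : ι → Set ((I → Bool) → Bool)}
    (h : ∀ i ∈ s, Derives A c (B i)) : Derives A (s.card * c) (⋃ i ∈ s, B i) := by
  classical
  induction s using Finset.induction_on with
  | empty => exact (of_subset (by simp)).mono subset_rfl subset_rfl (by simp)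
  | insert a s ha ih =>
    refine ((h a (by simp)).union (ih fun i hi => h i (by simp [hi]))).mono subset_rfl
      (by simp) ?_
    rw [Finset.card_insert_of_notMem ha, Nat.add_mul, one_mul, Nat.add_comm]

/-- A single instruction. -/
theorem gate (k : ℕ) (hk : k ≤ 3) (g : (Fin k → Bool) → Bool) (par : Fin k → (I → Bool) → Bool)
    (hpar : ∀ i, (∃ a, par i = fun x => x a) ∨ par i ∈ A) :
    Derives A 1 {fun x => g fun i => par i x} := by
  intro L hL hA
  exact ⟨_, IsStraightLine.cons k hk g par (fun i => (hpar i).imp_right (hA _)) hL,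
    fun f hf => List.mem_cons_of_mem _ hf, by simp, by simp⟩

theorem const (b : Bool) : Derives A 1 {fun _ => b} :=
  gate 0 (by omega) (fun _ => b) Fin.elim0 fun i => i.elim0

/-- Any function of a single input bit. -/
theorem unary (g : Bool → Bool) (a : I) : Derives A 1 {fun x => g (x a)} :=
  gate 1 (by omega) (fun v => g (v 0)) (fun _ x => x a) fun _ => Or.inl ⟨a, rfl⟩

theorem binary (g : Bool → Bool → Bool) {u v : (I → Bool) → Bool} (hu : u ∈ A) (hv : v ∈ A) :
    Derives A 1 {fun x => g (u x) (v x)} :=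
  gate 2 (by omega) (fun w => g (w 0) (w 1)) ![u, v] fun i => by
    fin_cases i
    · exact Or.inr hu
    · exact Or.inr hv

end Derives

/-! ### Functions with values in a finite type -/

open Classical in
/-- The indicators of the events `φ = a`. A function `φ` of the input bits with values in a
finite type is represented in a straight-line program by these Boolean functions. -/
def indicators {I α : Type} (φ : (I → Bool) → α) : Set ((I → Bool) → Bool) :=
  Set.range fun (a : α) x => decide (φ x = a)

namespace Derives

variable {I α β : Type} {A : Set ((I → Bool) → Bool)}

open Classical in
theorem mem_finset (φ : (I → Bool) → α) (s : Finset α) :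
    Derives (indicators φ) (s.card + 1) {fun x => decide (φ x ∈ s)} := by
  induction s using Finset.induction_on with
  | empty => exact (const false).mono subset_rfl (by simp) (by simp)
  | insert a s ha ih =>
    have h := ih.trans (binary or (u := fun x => decide (φ x = a)) (v := fun x => decide (φ x ∈ s))
      (Or.inl ⟨a, rfl⟩) (Or.inr rfl))
    rw [Finset.card_insert_of_notMem ha]
    refine h.mono subset_rfl ?_ le_rfl
    simp

theorem map [Fintype α] [Fintype β] {c : ℕ} {φ : (I → Bool) → α}
    (h : Derives A c (indicators φ)) (g : α → β) :
    Derives A (c + Fintype.card β * (Fintype.card α + 1)) (indicators fun x => g (φ x)) := by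
  classical
  refine h.trans ((biUnion (c := Fintype.card α + 1)
    (B := fun b : β => {fun x => decide (g (φ x) = b)}) Finset.univ fun b _ => ?_).mono
    Set.subset_union_right ?_ le_rfl)
  · refine (mem_finset φ {a | g a = b}).mono subset_rfl ?_
      (Nat.add_le_add_right (Finset.card_le_univ _) 1)
    simp
  · rintro _ ⟨b, rfl⟩
    simp only [Set.mem_iUnion]
    exact ⟨b, Finset.mem_univ b, by congr!⟩

theorem prodMk [Fintype α] [Fintype β] {c d : ℕ} {φ : (I → Bool) → α} {ψ : (I → Bool) → β}
    (hφ : Derives A c (indicators φ)) (hψ : Derives A d (indicators ψ)) :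
    Derives A (c + d + Fintype.card α * Fintype.card β) (indicators fun x => (φ x, ψ x)) := by
  classical
  refine (hφ.union hψ).trans ((biUnion (A := indicators φ ∪ indicators ψ) (c := 1)
    (B := fun b : α × β => {fun x => decide (φ x = b.1) && decide (ψ x = b.2)}) Finset.univ
      fun b _ => ?_).mono Set.subset_union_right ?_ (by simp))
  · refine binary and (Or.inl ⟨b.1, ?_⟩) (Or.inr ⟨b.2, ?_⟩) <;> congr!
  · rintro _ ⟨b, rfl⟩
    simp only [Set.mem_iUnion]
    refine ⟨b, Finset.mem_univ b, ?_⟩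
    simp only [Set.mem_singleton_iff]
    funext x
    simp [Prod.ext_iff]

/-- A finite-valued function of at most one input bit. -/
theorem indicators_of_single_bit [Fintype α] (φ : (I → Bool) → α)
    (h : (∃ a, φ = fun _ => a) ∨ ∃ (i : I) (g : Bool → α), φ = fun x => g (x i)) :
    Derives ∅ (Fintype.card α) (indicators φ) := by
  classical
  refine (biUnion (c := 1) (B := fun a : α => {fun x => decide (φ x = a)}) Finset.univ
    fun a _ => ?_).mono subset_rfl ?_ (by simp)
  · rcases h with ⟨a', rfl⟩ | ⟨i, g, rfl⟩
    · exact const _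
    · exact unary (fun b => decide (g b = a)) i
  · rintro _ ⟨b, rfl⟩
    simp only [Set.mem_iUnion]
    exact ⟨b, Finset.mem_univ b, by congr!⟩

end Derives

/-! ### From straight-line programs to DAGs -/

/-- The instructions of a straight-line program with explicit indices: the entry with index `k`
refers only to larger indices. -/
theorem IsStraightLine.exists_gate {I : Type} {L : List ((I → Bool) → Bool)}
    (hL : IsStraightLine L) (k : Fin L.length) :
    ∃ (r : ℕ) (_ : r ≤ 3) (g : (Fin r → Bool) → Bool) (par : Fin r → I ⊕ Fin L.length),
      (∀ i w, par i = Sum.inr w → k < w) ∧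
      ∀ x, L[k] x = g fun i => Sum.elim x (fun w => L[w] x) (par i) := by
  induction hL with
  | nil => exact k.elim0
  | @cons L r hr g par hpar hL ih =>
    refine Fin.cases ?_ (fun k => ?_) k
    · have h : ∀ i, ∃ s : I ⊕ Fin (L.length + 1), (∀ w, s = Sum.inr w → 0 < w) ∧
          ∀ x, par i x = Sum.elim x (fun w => ((fun x => g fun i => par i x) :: L)[w] x) s := by
        intro i
        rcases hpar i with ⟨a, ha⟩ | hm
        · exact ⟨Sum.inl a, by simp, by simp [ha]⟩
        · obtain ⟨w, hw, hwe⟩ := List.getElem_of_mem hm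
          refine ⟨Sum.inr (Fin.succ ⟨w, hw⟩), ?_, ?_⟩
          · rintro _ ⟨⟩
            exact Fin.succ_pos _
          · simp [hwe]
      choose s hs1 hs2 using h
      refine ⟨r, hr, g, s, hs1, fun x => ?_⟩
      exact congrArg g (funext fun i => hs2 i x)
    · obtain ⟨r', hr', g', par', h1, h2⟩ := ih k
      refine ⟨r', hr', g', fun i => (par' i).map id Fin.succ, ?_, fun x => ?_⟩
      · intro i w hw
        rcases hp : par' i with a | v
        · simp [hp] at hw
        · simp only [hp, Sum.map_inr, Sum.inr.injEq] at hw
          rw [← hw]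
          exact Fin.succ_lt_succ_iff.2 (h1 i v hp)
      · refine (h2 x).trans (congrArg g' (funext fun i => ?_))
        rcases hp : par' i with a | v <;> simp [hp]

theorem IsStraightLine.exists_booleanDAG {I O : Type} {L : List ((I → Bool) → Bool)}
    (hL : IsStraightLine L) (out : O → (I → Bool) → Bool) (hout : ∀ o, out o ∈ L) :
    ∃ C : BooleanDAG I O, C.FanInLE 3 ∧ C.size = L.length ∧ C.depth ≤ L.length ∧
      ∀ x o, C.eval x o = out o x := by
  choose r hr g par hlt hval using hL.exists_gate
  choose w hw using fun o => List.getElem_of_mem (hout o)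
  choose hw hwe using hw
  let C : BooleanDAG I O :=
    { V := Fin L.length
      arity := r
      parent := par
      gate := g
      out := fun o => Sum.inr ⟨w o, hw o⟩
      acyclic := Subrelation.wf (r := fun a b : Fin L.length => b < a)
        (fun {a b} ⟨i, hi⟩ => hlt b i a hi) wellFounded_gt }
  have hCval : ∀ x (k : Fin L.length), C.val x k = L[k] x := by
    intro x k
    induction k using WellFoundedGT.induction with
    | ind k ih =>
      rw [C.val_eq, hval]
      refine congrArg (g k) (funext fun i => ?_)
      change Sum.elim x (C.val x) (par k i) = _
      rcases hp : par k i with a | v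
      · rfl
      · exact ih v (hlt k i v hp)
  have hlev : ∀ k : Fin L.length, C.level k ≤ L.length - k := by
    intro k
    induction k using WellFoundedGT.induction with
    | ind k ih =>
      rw [C.level_eq]
      have : (Finset.univ.sup fun i => Sum.elim (fun _ => 0) C.level (C.parent k i)) ≤
          L.length - k - 1 := by
        refine Finset.sup_le fun i _ => ?_
        change Sum.elim (fun _ => 0) C.level (par k i) ≤ _
        rcases hp : par k i with a | v
        · simp
        · have h1 : (k : ℕ) < v := hlt k i v hp
          have h2 := ih v (hlt k i v hp)
          simp only [Sum.elim_inr]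
          omega
      have := k.2
      omega
  refine ⟨C, hr, by simp [BooleanDAG.size, C], ?_, fun x o => ?_⟩
  · exact Finset.sup_le fun k _ => (hlev k).trans (Nat.sub_le _ _)
  · change C.val x ⟨w o, hw o⟩ = _
    rw [hCval]
    exact congrFun (hwe o) x

/-! ### From straight-line programs to ReLU networks -/

theorem bitVal_nonneg (b : Bool) : 0 ≤ bitVal b := by
  unfold bitVal
  split <;> norm_num

/-- The indicator of a point of the cube `{0,1}^k` is a single ReLU unit. -/
theorem max_sum_sub_eq_indicator {k : ℕ} (a v : Fin k → Bool) :
    max ((∑ i, if a i then bitVal (v i) else 1 - bitVal (v i)) + (1 - (k : ℝ))) 0 =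
      if v = a then 1 else 0 := by
  have hterm : ∀ i, (if a i then bitVal (v i) else 1 - bitVal (v i)) =
      if v i = a i then (1 : ℝ) else 0 := by
    intro i
    cases a i <;> cases v i <;> simp [bitVal]
  simp only [hterm]
  by_cases h : v = a
  · simp [h]
  · rw [if_neg h]
    obtain ⟨j, hj⟩ := Function.ne_iff.1 h
    apply max_eq_right
    have : (∑ i, if v i = a i then (1 : ℝ) else 0) ≤ ∑ i, if i = j then 0 else 1 := by
      refine Finset.sum_le_sum fun i _ => ?_
      by_cases hi : i = j
      · subst hi; simp [hj]
      · simp only [hi, if_false]; split <;> norm_num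
    have h2 : (∑ i : Fin k, if i = j then (0 : ℝ) else 1) = k - 1 := by
      have : ∀ i : Fin k, (if i = j then (0 : ℝ) else 1) = 1 - if i = j then 1 else 0 := by
        intro i; split <;> norm_num
      simp [this, Finset.sum_sub_distrib]
    linarith

namespace ReLUNet

variable {O ι κ : Type} [Fintype ι] [Fintype κ]

theorem exists_reindex (Ψ : ReLUNet O κ) (e : κ ≃ ι) :
    ∃ Φ : ReLUNet O ι, Φ.size = Ψ.size ∧ Φ.depth = Ψ.depth ∧
      ∀ z : ι → ℝ, Φ.eval z = Ψ.eval fun k => z (e k) := by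
  have hsum : ∀ (w : κ → ℝ) (z : ι → ℝ), ∑ i, w (e.symm i) * z i = ∑ k, w k * z (e k) :=
    fun w z => (Equiv.sum_comp e _).symm.trans (by simp)
  cases Ψ with
  | output W c =>
    refine ⟨output (fun o i => W o (e.symm i)) c, ?_, rfl, fun z => ?_⟩
    · simp only [size, Nat.card_congr e]
    · funext o
      simp only [eval, Matrix.mulVec, dotProduct, hsum]
  | hidden W c rest =>
    refine ⟨hidden (fun o i => W o (e.symm i)) c rest, ?_, rfl, fun z => ?_⟩
    · simp only [size, Nat.card_congr e]
    · simp only [eval, Matrix.mulVec, dotProduct, hsum]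

/-- A hidden layer with units indexed by an arbitrary finite type. -/
theorem exists_hidden (W : Matrix κ ι ℝ) (c : κ → ℝ) (Ψ : ReLUNet O κ) :
    ∃ Φ : ReLUNet O ι, Φ.size = Fintype.card κ * Fintype.card ι + Fintype.card κ + Ψ.size ∧
      Φ.depth = 1 + Ψ.depth ∧
      ∀ z : ι → ℝ, Φ.eval z = Ψ.eval fun k => max ((W.mulVec z) k + c k) 0 := by
  let e := Fintype.equivFin κ
  obtain ⟨Ψ', h1, h2, h3⟩ := Ψ.exists_reindex e
  refine ⟨hidden (fun k i => W (e.symm k) i) (fun k => c (e.symm k)) Ψ', ?_, ?_, fun z => ?_⟩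
  · simp [size, h1]
  · simp [depth, h2]
  · refine (h3 _).trans ?_
    simp [Matrix.mulVec]

end ReLUNet

/-- Each instruction of a straight-line program becomes one hidden layer, which carries along the
values `z` of the previous layer and adds at most eight units, the indicators of the assignments to
the arguments of the instruction. The input bits and the entries of the program stay affine
functions of `z`. The layers are put in front of an arbitrary network `Ψ`. -/
theorem IsStraightLine.exists_reLUNet {I : Type} [Fintype I] {L : List ((I → Bool) → Bool)}
    (hL : IsStraightLine L) :
    ∃ (κ : Type) (_ : Fintype κ) (z : (I → Bool) → κ → ℝ),
      Fintype.card κ ≤ Fintype.card I + 8 * L.length ∧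
      (∀ x k, 0 ≤ z x k) ∧
      (∀ f, ((∃ a, f = fun x => x a) ∨ f ∈ L) →
        ∃ (w : κ → ℝ) (c : ℝ), ∀ x, bitVal (f x) = (∑ k, w k * z x k) + c) ∧
      ∀ (O : Type) (Ψ : ReLUNet O κ), ∃ Φ : ReLUNet O I,
        Φ.size ≤ Ψ.size + L.length * (2 * (Fintype.card I + 8 * L.length) ^ 2) ∧
        Φ.depth = L.length + Ψ.depth ∧
        ∀ x, Φ.eval (fun a => bitVal (x a)) = Ψ.eval (z x) := by
  classical
  induction hL with
  | nil =>
    refine ⟨I, inferInstance, fun x a => bitVal (x a), by simp, fun x k => bitVal_nonneg _, ?_,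
      fun O Ψ => ⟨Ψ, by simp, by simp, fun x => rfl⟩⟩
    rintro f (⟨a, rfl⟩ | h)
    · exact ⟨fun k => if k = a then 1 else 0, 0, by simp⟩
    · simp at h
  | @cons L r hr g par hpar hL ih =>
    obtain ⟨κ, _, z, hcard, hnn, haff, hnet⟩ := ih
    choose w c hwc using fun i => haff (par i) (hpar i)
    let κ' := κ ⊕ (Fin r → Bool)
    let z' : (I → Bool) → κ' → ℝ := fun x => Sum.elim (z x)
      fun a => if (fun i => par i x) = a then 1 else 0
    have hcard' : Fintype.card κ' ≤ Fintype.card I + 8 * (L.length + 1) := by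
      have : 2 ^ r ≤ 2 ^ 3 := Nat.pow_le_pow_right (by norm_num) hr
      simp [κ']
      omega
    refine ⟨κ', inferInstance, z', by simpa using hcard', ?_, ?_, fun O Ψ => ?_⟩
    · rintro x (k | a)
      · exact hnn x k
      · simp only [z', Sum.elim_inr]; split <;> norm_num
    · intro f hf
      have hf' : (f = fun x => g fun i => par i x) ∨ ((∃ a, f = fun x => x a) ∨ f ∈ L) := by
        rcases hf with hf | hf
        · exact Or.inr (Or.inl hf)
        · rcases List.mem_cons.1 hf with hf | hf
          · exact Or.inl hf
          · exact Or.inr (Or.inr hf)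
      rcases hf' with rfl | hf
      · exact ⟨Sum.elim (fun _ => 0) fun a => bitVal (g a), 0, fun x => by simp [z', κ']⟩
      · obtain ⟨u, b, hu⟩ := haff f hf
        exact ⟨Sum.elim u fun _ => 0, b, fun x => by simp [z', κ', hu]⟩
    · -- The weights of the unit for the assignment `a`: the argument `i` contributes its value
      -- if `a i` is true, and one minus its value otherwise.
      obtain ⟨Ψ', h1, h2, h3⟩ := Ψ.exists_hidden (ι := κ)
        (Sum.elim (fun k k' => if k' = k then 1 else 0)
          fun a k' => ∑ i, if a i then w i k' else -w i k')
        (Sum.elim (fun _ => 0)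
          fun a => (∑ i, if a i then c i else 1 - c i) + (1 - (r : ℝ)))
      obtain ⟨Φ, k1, k2, k3⟩ := hnet O Ψ'
      refine ⟨Φ, ?_, ?_, fun x => ?_⟩
      · rw [h1] at k1
        simp only [List.length_cons]
        set N := Fintype.card I + 8 * (L.length + 1) with hN
        have e1 : Fintype.card (κ ⊕ (Fin r → Bool)) * Fintype.card κ +
            Fintype.card (κ ⊕ (Fin r → Bool)) ≤ 2 * N ^ 2 := by
          have : Fintype.card κ + 1 ≤ N := by omega
          calc _ = Fintype.card κ' * (Fintype.card κ + 1) := by rw [Nat.mul_add, mul_one]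
            _ ≤ N * N := Nat.mul_le_mul hcard' this
            _ ≤ 2 * N ^ 2 := by nlinarith
        have e2 : L.length * (2 * (Fintype.card I + 8 * L.length) ^ 2) ≤
            L.length * (2 * N ^ 2) := by
          gcongr
          omega
        have e3 : (L.length + 1) * (2 * N ^ 2) = L.length * (2 * N ^ 2) + 2 * N ^ 2 := by ring
        omega
      · rw [k2, h2, List.length_cons]; omega
      · rw [k3, h3]
        congr 1
        funext k
        rcases k with k | a
        · simp [z', Matrix.mulVec, dotProduct, hnn]
        · simp only [z', Sum.elim_inr, ← max_sum_sub_eq_indicator, hwc]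
          congr 1
          simp only [Matrix.mulVec, dotProduct, Sum.elim_inr, ← add_assoc]
          congr 1
          simp only [Finset.sum_mul]
          rw [Finset.sum_comm, ← Finset.sum_add_distrib]
          refine Finset.sum_congr rfl fun i _ => ?_
          cases a i
          · simp; ring
          · simp

/-! ### Simulating a Turing machine -/

namespace TuringMachine

open Turing

variable (M : TuringMachine)

/-- One step of `M`, where a halted configuration stays as it is. -/
def next (c : TM0.Cfg M.Γ M.Λ) : TM0.Cfg M.Γ M.Λ := (TM0.step M.table c).getD c

/-- The configuration of `M` after `t` steps on the given input. -/
def run (input : List IOSymbol) (t : ℕ) : TM0.Cfg M.Γ M.Λ :=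
  M.next^[t] (TM0.init (input.map M.sym))

/-- The next state, in terms of the state and the scanned symbol. -/
def nextState (p : M.Λ × M.Γ) : M.Λ := ((M.table p.1 p.2).map Prod.fst).getD p.1

/-- The next symbol in a cell, in terms of the state, the scanned symbol, and the symbols in the
cell and its two neighbours. Positions are relative to the head, so that a move of the head shifts
the tape; `atHead` says whether the cell is the scanned one. -/
def nextSymbol (atHead : Bool) (p : (M.Λ × M.Γ) × M.Γ × M.Γ × M.Γ) : M.Γ :=
  match M.table p.1.1 p.1.2 with
  | none => p.2.2.1
  | some (_, TM0.Stmt.move Dir.left) => p.2.1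
  | some (_, TM0.Stmt.move Dir.right) => p.2.2.2
  | some (_, TM0.Stmt.write a) => if atHead then a else p.2.2.1

theorem next_q (c : TM0.Cfg M.Γ M.Λ) : (M.next c).q = M.nextState (c.q, c.Tape.nth 0) := by
  obtain ⟨q, T⟩ := c
  simp only [next, nextState, TM0.step, Tape.nth_zero]
  rcases M.table q T.head with _ | ⟨q', _ | _⟩ <;> rfl

theorem next_nth (c : TM0.Cfg M.Γ M.Λ) (i : ℤ) : (M.next c).Tape.nth i =
    M.nextSymbol (decide (i = 0))
      ((c.q, c.Tape.nth 0), c.Tape.nth (i - 1), c.Tape.nth i, c.Tape.nth (i + 1)) := by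
  obtain ⟨q, T⟩ := c
  simp only [next, nextSymbol, TM0.step, Tape.nth_zero]
  rcases M.table q T.head with _ | ⟨q', (_ | _) | a⟩
  · rfl
  · simp
  · simp
  · simp [Tape.write_nth]

variable {M} in
theorem OutputsWithin.right₀_run {input output : List IOSymbol} {T : ℕ}
    (h : M.OutputsWithin input output T) :
    (M.run input T).Tape.right₀ = ListBlank.mk (output.map M.sym) := by
  obtain ⟨k, hk, c, hkc, hc, hout⟩ := h
  have hiter : ∀ k a,
      (fun o : Option (TM0.Cfg M.Γ M.Λ) => o.bind (TM0.step M.table))^[k] (some a) = some c →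
        M.next^[k] a = c := by
    intro k
    induction k with
    | zero => intro a h; simpa using h
    | succ k ih =>
      intro a h
      rw [Function.iterate_succ_apply, Option.bind_some] at h
      rw [Function.iterate_succ_apply]
      rcases hs : TM0.step M.table a with _ | a'
      · rw [hs, Function.iterate_fixed (by rfl)] at h
        cases h
      · rw [hs] at h
        rw [show M.next a = a' by simp [next, hs]]
        exact ih a' h
  have hfix : M.next c = c := by simp [next, hc]
  rw [← hout, run, ← Nat.sub_add_cancel hk, Function.iterate_add_apply, hiter k _ hkc,
    Function.iterate_fixed hfix]

/-- The indicators describing a configuration that depends on the input bits: those of its state, and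
those of its cells at distance at most `r` from the head. -/
def window {I : Type} (c : (I → Bool) → TM0.Cfg M.Γ M.Λ) (r : ℕ) : Set ((I → Bool) → Bool) :=
  indicators (fun x => (c x).q) ∪
    ⋃ i ∈ Finset.Icc (-(r : ℤ)) r, indicators fun x => (c x).Tape.nth i

variable {M}

theorem nth_subset_window {I : Type} (c : (I → Bool) → TM0.Cfg M.Γ M.Λ) {r : ℕ} {i : ℤ}
    (h1 : -(r : ℤ) ≤ i) (h2 : i ≤ r) : indicators (fun x => (c x).Tape.nth i) ⊆ M.window c r := by
  refine Set.subset_union_of_subset_right ?_ _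
  exact Set.subset_biUnion_of_mem (u := fun i : ℤ => indicators fun x => (c x).Tape.nth i)
    (Finset.mem_coe.2 (Finset.mem_Icc.2 ⟨h1, h2⟩))

theorem derives_window {I : Type} {A : Set ((I → Bool) → Bool)} {K : ℕ}
    (c : (I → Bool) → TM0.Cfg M.Γ M.Λ) (r : ℕ)
    (hq : Derives A K (indicators fun x => (c x).q))
    (hc : ∀ i : ℤ, -(r : ℤ) ≤ i → i ≤ r → Derives A K (indicators fun x => (c x).Tape.nth i)) :
    Derives A ((2 * r + 2) * K) (M.window c r) := by
  refine (hq.union (Derives.biUnion (Finset.Icc (-(r : ℤ)) r) fun i hi =>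
    hc i (Finset.mem_Icc.1 hi).1 (Finset.mem_Icc.1 hi).2)).mono subset_rfl subset_rfl ?_
  rw [Int.card_Icc, show ((r : ℤ) + 1 - -(r : ℤ)).toNat = 2 * r + 1 by omega]
  exact le_of_eq (by ring)

variable (M)

/-- One step of the machine costs a constant number of instructions for each cell, and decreases
the radius of the known part of the tape by one. -/
theorem exists_derives_next : ∃ K : ℕ, ∀ (I : Type) (c : (I → Bool) → TM0.Cfg M.Γ M.Λ) (r : ℕ),
    Derives (M.window c (r + 1)) ((2 * r + 2) * K) (M.window (fun x => M.next (c x)) r) := by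
  have := Fintype.ofFinite M.Γ
  have := Fintype.ofFinite M.Λ
  have hscan : ∃ K : ℕ, ∀ (I : Type) (c : (I → Bool) → TM0.Cfg M.Γ M.Λ) (r : ℕ),
      Derives (M.window c (r + 1)) K (indicators fun x => ((c x).q, (c x).Tape.nth 0)) :=
    ⟨_, fun I c r => (Derives.of_subset Set.subset_union_left).prodMk
      (Derives.of_subset (nth_subset_window c (by omega) (by omega)))⟩
  obtain ⟨K₁, hK₁⟩ := hscan
  have hsymbol : ∃ K : ℕ, ∀ (I : Type) (c : (I → Bool) → TM0.Cfg M.Γ M.Λ) (r : ℕ) (i : ℤ),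
      -(r : ℤ) ≤ i → i ≤ r → Derives (M.window c (r + 1)) K
        (indicators fun x => M.nextSymbol (decide (i = 0)) (((c x).q, (c x).Tape.nth 0),
          (c x).Tape.nth (i - 1), (c x).Tape.nth i, (c x).Tape.nth (i + 1))) :=
    ⟨_, fun I c r i h1 h2 => ((hK₁ I c r).prodMk <|
      (Derives.of_subset (nth_subset_window c (by omega) (by omega))).prodMk <|
      (Derives.of_subset (nth_subset_window c (by omega) (by omega))).prodMk
      (Derives.of_subset (nth_subset_window c (by omega) (by omega)))).map
        (M.nextSymbol (decide (i = 0)))⟩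
  obtain ⟨K₂, hK₂⟩ := hsymbol
  refine ⟨K₁ + Fintype.card M.Λ * (Fintype.card (M.Λ × M.Γ) + 1) + K₂, fun I c r =>
    derives_window _ r ?_ fun i h1 h2 => ?_⟩
  · simp only [next_q]
    exact ((hK₁ I c r).map M.nextState).mono subset_rfl subset_rfl (by omega)
  · simp only [next_nth]
    exact (hK₂ I c r i h1 h2).mono subset_rfl subset_rfl (by omega)

/-- In the initial configuration, every cell depends on at most one input bit. The input word is
given by a template in which some of the symbols are replaced by input bits. -/
theorem exists_derives_init : ∃ K : ℕ, ∀ (I : Type) (w : List (I ⊕ IOSymbol)) (r : ℕ),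
    Derives ∅ ((2 * r + 2) * K)
      (M.window (fun x => M.run (w.map (Sum.elim (fun a => IOSymbol.bit (x a)) id)) 0) r) := by
  have := Fintype.ofFinite M.Γ
  have := Fintype.ofFinite M.Λ
  refine ⟨Fintype.card M.Λ + Fintype.card M.Γ, fun I w r =>
    derives_window _ r ?_ fun i _ _ => ?_⟩
  · exact (Derives.indicators_of_single_bit _ (Or.inl ⟨default, rfl⟩)).mono subset_rfl subset_rfl
      (by omega)
  · refine (Derives.indicators_of_single_bit _ ?_).mono subset_rfl subset_rfl
      (Nat.le_add_left _ _)
    rcases i with k | k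
    · have hk : ∀ l : List M.Γ, (Tape.mk₁ l).nth (Int.ofNat k) = (l[k]?).getD default := by
        intro l
        change (Tape.mk' _ _).nth (k : ℤ) = _
        rw [Tape.mk'_nth_nat, ListBlank.nth_mk, List.getI_eq_getElem?_getD]
      simp only [run, Function.iterate_zero, id_eq, TM0.init, hk, List.getElem?_map]
      rcases w[k]? with _ | a | s
      · exact Or.inl ⟨default, rfl⟩
      · exact Or.inr ⟨a, fun b => M.sym (IOSymbol.bit b), rfl⟩
      · exact Or.inl ⟨M.sym s, rfl⟩
    · refine Or.inl ⟨default, funext fun x => ?_⟩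
      change (ListBlank.mk []).nth k = _
      simp [ListBlank.nth_mk]

theorem exists_derives_run : ∃ K : ℕ, ∀ (I : Type) (w : List (I ⊕ IOSymbol)) (t r : ℕ),
    Derives ∅ ((t + 1) * ((2 * (r + t) + 2) * K))
      (M.window (fun x => M.run (w.map (Sum.elim (fun a => IOSymbol.bit (x a)) id)) t) r) := by
  obtain ⟨K₁, h₁⟩ := M.exists_derives_next
  obtain ⟨K₂, h₂⟩ := M.exists_derives_init
  refine ⟨K₁ + K₂, fun I w t => ?_⟩
  induction t with
  | zero =>
    intro r
    refine (h₂ I w r).mono subset_rfl subset_rfl ?_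
    simp only [zero_add, one_mul, add_zero]
    gcongr
    exact Nat.le_add_left _ _
  | succ t ih =>
    intro r
    have h := (ih (r + 1)).trans ((h₁ I _ r).mono Set.subset_union_right subset_rfl le_rfl)
    simp only [run, Function.iterate_succ_apply'] at h ⊢
    refine h.mono subset_rfl subset_rfl ?_
    have e : (2 * r + 2) * K₁ ≤ (2 * (r + (t + 1)) + 2) * (K₁ + K₂) :=
      Nat.mul_le_mul (by omega) (by omega)
    calc _ ≤ (t + 1) * ((2 * (r + 1 + t) + 2) * (K₁ + K₂)) +
          (2 * (r + (t + 1)) + 2) * (K₁ + K₂) := Nat.add_le_add_left e _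
      _ = _ := by ring

end TuringMachine

/-! ### The discretization as a straight-line program -/

theorem getElem?_outputWord {m b : ℕ} (y : BitCode m b) (j : Fin m) (i : Fin b) :
    (outputWord y)[(j : ℕ) * b + i]? = some (IOSymbol.bit (y j i)) := by
  have hlt : (j : ℕ) * b + i < m * b := by
    calc (j : ℕ) * b + i < j * b + b := by omega
      _ = (j + 1) * b := by ring
      _ ≤ m * b := Nat.mul_le_mul_right _ j.2
  have h : outputWord y =
      List.ofFn fun k : Fin (m * b) => IOSymbol.bit (y k.divNat k.modNat) := by
    rw [List.ofFn_mul, outputWord]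
    refine congrArg List.flatten (congrArg List.ofFn (funext fun j => congrArg List.ofFn
      (funext fun i => ?_)))
    have hb : 0 < b := i.pos
    congr 2 <;> ext
    · simp [Fin.divNat, Nat.add_mul_div_right, Nat.add_comm, hb]
    · simp [Fin.modNat, Nat.mod_eq_of_lt]
  have hb : 0 < b := i.pos
  rw [h, List.getElem?_ofFn, dif_pos hlt]
  congr 3 <;> ext
  · simp [Fin.divNat, Nat.add_mul_div_right, Nat.add_comm, hb]
  · simp [Fin.modNat, Nat.mod_eq_of_lt]

/-- The positions of the input bits in the input word do not depend on the code. -/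
theorem exists_inputWord_eq_map (d n b : ℕ) : ∃ w : List ((Fin d × Fin n) ⊕ IOSymbol),
    ∀ q : BitCode d n,
      inputWord q b = w.map (Sum.elim (fun s => IOSymbol.bit (q s.1 s.2)) id) := by
  refine ⟨(List.ofFn fun j => (List.ofFn fun i => Sum.inl (j, i)) ++
    [Sum.inr IOSymbol.sep]).flatten ++ List.replicate b (Sum.inr (IOSymbol.bit true)), fun q => ?_⟩
  simp [inputWord, List.map_flatten, List.map_ofFn, Function.comp_def]

/-- A polynomial-time computable family is computed by straight-line programs of polynomial
length. -/
theorem PolyTimeComputable.exists_isStraightLine {d m : ℕ} {X : ℕ → ℕ → Set (UnitCube d)}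
    {F : PrecisionFamily d m} (hF : PolyTimeComputable X F) :
    ∃ p : Polynomial ℕ, ∀ n b : ℕ, ∃ L : List ((Fin d × Fin n → Bool) → Bool),
      IsStraightLine L ∧ L.length ≤ p.eval (n + b) ∧
      ∃ out : Fin m × Fin b → (Fin d × Fin n → Bool) → Bool, (∀ o, out o ∈ L) ∧
        ∀ x ∈ X n b, ∀ j i,
          out (j, i) (fun s => quantize n x s.1 s.2) = F n b (quantize n x) j i := by
  classical
  obtain ⟨M, p, hM⟩ := hF
  obtain ⟨K, hK⟩ := M.exists_derives_run
  refine ⟨(p + 1) * ((2 * (Polynomial.C m * Polynomial.X + p) + 2) * Polynomial.C K),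
    fun n b => ?_⟩
  obtain ⟨w, hw⟩ := exists_inputWord_eq_map d n b
  set T := p.eval (n + b) with hT
  obtain ⟨L, hL, -, hwin, hlen⟩ := hK _ w T (m * b) [] IsStraightLine.nil (by simp)
  refine ⟨L, hL, hlen.trans ?_, fun o x => decide ((M.run (w.map (Sum.elim
    (fun s => IOSymbol.bit (x s)) id)) T).Tape.nth ((o.1 : ℕ) * b + (o.2 : ℕ) : ℕ) =
      M.sym (IOSymbol.bit true)), fun o => hwin _ ?_, fun x hx j i => ?_⟩
  · simp only [List.length_nil, zero_add, Polynomial.eval_mul, Polynomial.eval_add,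
      Polynomial.eval_one, Polynomial.eval_C, Polynomial.eval_X, Polynomial.eval_ofNat, ← hT]
    gcongr
    omega
  · refine TuringMachine.nth_subset_window (i := ((o.1 : ℕ) * b + (o.2 : ℕ) : ℕ)) _ (by omega) ?_
      ⟨M.sym (IOSymbol.bit true), by congr!⟩
    have : (o.1 : ℕ) * b + o.2 ≤ m * b := by
      calc (o.1 : ℕ) * b + o.2 ≤ o.1 * b + b := by omega
        _ = (o.1 + 1) * b := by ring
        _ ≤ m * b := Nat.mul_le_mul_right _ o.1.2
    exact_mod_cast this
  · have h := (hM n b x hx).right₀_run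
    rw [hw] at h
    have h2 : (M.run (w.map (Sum.elim (fun s => IOSymbol.bit (quantize n x s.1 s.2)) id)) T
        ).Tape.nth ((j : ℕ) * b + (i : ℕ) : ℕ) =
          M.sym (IOSymbol.bit (F n b (quantize n x) j i)) := by
      rw [← Turing.Tape.right₀_nth, h, Turing.ListBlank.nth_mk, List.getI_eq_getElem?_getD,
        List.getElem?_map, getElem?_outputWord]
      rfl
    simp only [h2, M.sym_injective.eq_iff]
    cases F n b (quantize n x) j i <;> simp

/-! ### Networks for the discretization -/

/-- The decoder is affine, so that it can be merged into the output layer. -/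
theorem IsStraightLine.exists_reLUNet_decode {I : Type} [Fintype I] {m b : ℕ} (lo hi : Fin m → ℝ)
    {L : List ((I → Bool) → Bool)} (hL : IsStraightLine L)
    (out : Fin m × Fin b → (I → Bool) → Bool) (hout : ∀ o, out o ∈ L) :
    ∃ Φ : ReLUNet (Fin m) I,
      Φ.size ≤ m * (Fintype.card I + 8 * L.length) + m +
        L.length * (2 * (Fintype.card I + 8 * L.length) ^ 2) ∧
      Φ.depth = L.length + 1 ∧
      ∀ x, Φ.eval (fun a => bitVal (x a)) = decode lo hi fun j i => out (j, i) x := by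
  obtain ⟨κ, _, z, hcard, -, haff, hnet⟩ := hL.exists_reLUNet
  choose w c hwc using fun o => haff (out o) (Or.inr (hout o))
  obtain ⟨Φ, h1, h2, h3⟩ := hnet (Fin m) (ReLUNet.output
    (fun j k => (hi j - lo j) * ∑ i : Fin b, w (j, i) k * (2 : ℝ)⁻¹ ^ ((i : ℕ) + 1))
    (fun j => lo j + (hi j - lo j) * ∑ i : Fin b, c (j, i) * (2 : ℝ)⁻¹ ^ ((i : ℕ) + 1)))
  refine ⟨Φ, h1.trans ?_, h2, fun x => (h3 x).trans ?_⟩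
  · simp only [ReLUNet.size, Nat.card_eq_fintype_card, Fintype.card_fin]
    gcongr
  · funext j
    simp only [ReLUNet.eval, decode, Matrix.mulVec, dotProduct, hwc, add_mul,
      Finset.sum_add_distrib, mul_assoc, ← Finset.mul_sum, Finset.sum_mul]
    rw [Finset.sum_comm]
    simp only [mul_comm ((2 : ℝ)⁻¹ ^ _)]
    ring

theorem mainTheorem1 {d m : ℕ} (lo hi : Fin m → ℝ) (X : ℕ → ℕ → Set (UnitCube d))
    (f : UnitCube d → Fin m → ℝ) (hf : EfficientlyTuringComputable lo hi X f) :
    (∃ F : PrecisionFamily d m, IsDiscretization lo hi X f F ∧ PolyTimeComputable X F) ∧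
    ∀ F : PrecisionFamily d m, IsDiscretization lo hi X f F → PolyTimeComputable X F →
      ∃ p : Polynomial ℕ, ∀ n b : ℕ,
        (∃ C : BooleanDAG (Fin d × Fin n) (Fin m × Fin b),
          C.FanInLE 3 ∧ C.size ≤ p.eval (n + b) ∧ C.depth ≤ p.eval (n + b) ∧
          ∀ x ∈ X n b, ∀ (j : Fin m) (i : Fin b),
            C.eval (fun s => quantize n x s.1 s.2) (j, i) = F n b (quantize n x) j i) ∧
        (∃ Φ : ReLUNet (Fin m) (Fin d × Fin n),
          Φ.size ≤ p.eval (n + b) ∧ Φ.depth ≤ p.eval (n + b) ∧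
          ∀ x ∈ X n b,
            ‖Φ.eval (fun s => bitVal (quantize n x s.1 s.2)) - f x‖ ≤ (2 : ℝ)⁻¹ ^ b) := by
  refine ⟨(efficientlyTuringComputable_iff lo hi X f).1 hf, fun F hF hpoly => ?_⟩
  obtain ⟨p, hp⟩ := hpoly.exists_isStraightLine
  let N : Polynomial ℕ := Polynomial.C d * Polynomial.X + 8 * p
  refine ⟨Polynomial.C m * N + Polynomial.C m + p * (2 * N ^ 2) + (p + 1), fun n b => ?_⟩
  obtain ⟨L, hL, hlen, out, hout, hval⟩ := hp n b
  set s := p.eval (n + b) with hs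
  have heval : (Polynomial.C m * N + Polynomial.C m + p * (2 * N ^ 2) + (p + 1)).eval (n + b) =
      m * (d * (n + b) + 8 * s) + m + s * (2 * (d * (n + b) + 8 * s) ^ 2) + (s + 1) := by
    simp [N, hs]
  rw [heval]
  constructor
  · obtain ⟨C, h1, h2, h3, h4⟩ := hL.exists_booleanDAG out hout
    exact ⟨C, h1, by omega, by omega, fun x hx j i => (h4 _ _).trans (hval x hx j i)⟩
  · obtain ⟨Φ, h1, h2, h3⟩ := hL.exists_reLUNet_decode lo hi out hout
    refine ⟨Φ, h1.trans ?_, by omega, fun x hx => ?_⟩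
    · rw [Fintype.card_prod, Fintype.card_fin, Fintype.card_fin]
      refine le_trans ?_ (Nat.le_add_right _ _)
      gcongr <;> omega
    · rw [h3 fun s => quantize n x s.1 s.2]
      simp only [hval x hx]
      exact hF n b x hx
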